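/- Let $x=(x_1,\dots,x_n)$ be variables and $y=(y_1,\dots,y_t)$ parameters, let $\mathbb K=\mathbb Q(y)$, and let $f=(f_1,\dots,f_n)$ be polynomials in $\mathbb Q[y][x]$. Let $d$ be the maximum of the total degrees of the $f_i$ in $(y,x)$. Assume that $f$ is an affine regular sequence with respect to $x$: if ${}^Hf_i$ denotes the homogeneous component of largest degree in $x$ of $f_i$, then for every $i$ the polynomial ${}^Hf_i$ is not a zero divisor in $\mathbb K[x]/\langle {}^Hf_1,\dots,{}^Hf_{i-1}\rangle$. Let $\mathcal G$ be the reduced Gröbner basis of $\langle f\rangle\subset\mathbb Q[y,x]$ with respect to the elimination order $\mathrm{grevlex}(x)\succ\mathrm{grevlex}(y)$ (with $x_1\succ\dots\succ x_n$ and $y_1\succ\dots\succ y_t$). Let $\mathcal B$ be the set of monomials in $x$ that are not divisible by the leading monomial with respect to $\mathrm{grevlex}(x)$ of any $g\in\mathcal G$, where $g$ is viewed as an element of $\mathbb K[x]$. Let $A_{\mathbb K}=\mathbb K[x]/\langle f\rangle_{\mathbb K}$, where $\langle f\rangle_{\mathbb K}$ is the ideal of $\mathbb K[x]$ generated by $f$.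 Then $\mathcal B=\{b_1,\dots,b_\delta\}$ is finite, its classes form a $\mathbb K$-basis of $A_{\mathbb K}$, and $$\deg b_i\le n(d-1)\ \text{ for all } i,\qquad 2\sum_{i=1}^{\delta}\deg b_i\le n(d-1)d^n.$$ Let $\mathcal H=(h_{i,j})_{1\le i,j\le\delta}$ be the parametric Hermite matrix of $f$ with respect to $\mathcal B$, that is, $h_{i,j}\in\mathbb K$ is the trace of the multiplication by $b_ib_j$ on $A_{\mathbb K}$. Assume in addition that every $g\in\mathcal G$ has total degree in $(y,x)$ equal to its partial degree in $x$ (Assumption E). Then every minor of $\mathcal H$, including $\det\mathcal H$, is a polynomial in $\mathbb Q[y]$ of total degree at most $n(d-1)d^n$. -/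

import Mathlib

open MvPolynomial

namespace ParamHermite

/-! ### The graded reverse lexicographic order -/

/-- Exponent vectors of monomials in `x₁, …, xₙ`, a type synonym that carries the graded reverse
lexicographic order with `x₁ ≻ ⋯ ≻ xₙ`. -/
def Grevlex (n : ℕ) : Type := Fin n →₀ ℕ

namespace Grevlex

variable {n : ℕ}

noncomputable instance : AddCommMonoid (Grevlex n) := (inferInstance : AddCommMonoid (Fin n →₀ ℕ))

/-- The comparison key: first the total degree, then the exponents read from the last variable to
the first one, a smaller exponent making the monomial larger. -/
noncomputable def key (a : Grevlex n) : ℕ ×ₗ Lex ((Fin n)ᵒᵈ → ℕᵒᵈ) :=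
  toLex (Finsupp.degree (show Fin n →₀ ℕ from a),
    toLex fun i => OrderDual.toDual ((show Fin n →₀ ℕ from a) (OrderDual.ofDual i)))

theorem key_injective : Function.Injective (key (n := n)) := by
  intro a b h
  have h2 := congrArg (fun z => ofLex (ofLex z).2) h
  refine Finsupp.ext fun i => ?_
  exact congrFun h2 (OrderDual.toDual i)

noncomputable instance : LinearOrder (Grevlex n) := LinearOrder.lift' key key_injective

/-- `x^a ≺ x^b` in the graded reverse lexicographic order if and only if `deg a < deg b`, or the
degrees agree and the last nonzero entry of `b - a` is negative. -/
theorem lt_iff (a b : Fin n →₀ ℕ) :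
    (show Grevlex n from a) < (show Grevlex n from b) ↔
      a.degree < b.degree ∨
        a.degree = b.degree ∧ ∃ i, (∀ j, i < j → a j = b j) ∧ b i < a i := by
  change key (n := n) a < key (n := n) b ↔ _
  unfold key
  rw [Prod.Lex.toLex_lt_toLex]
  refine or_congr Iff.rfl (and_congr Iff.rfl ?_)
  constructor
  · rintro ⟨i, h1, h2⟩
    exact ⟨OrderDual.ofDual i, fun j hj => h1 (OrderDual.toDual j) hj, h2⟩
  · rintro ⟨i, h1, h2⟩
    exact ⟨OrderDual.toDual i, fun j hj => h1 (OrderDual.ofDual j) hj, h2⟩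

theorem add_lt_add_left' (a b c : Fin n →₀ ℕ)
    (h : (show Grevlex n from a) < (show Grevlex n from b)) :
    (show Grevlex n from a + c) < (show Grevlex n from b + c) := by
  rw [lt_iff] at h ⊢
  simp only [map_add, Finsupp.add_apply]
  rcases h with h | ⟨h, i, h1, h2⟩
  · exact Or.inl (by omega)
  · exact Or.inr ⟨by omega, i, fun j hj => by rw [h1 j hj], by omega⟩

instance : IsOrderedAddMonoid (Grevlex n) where
  add_le_add_left a b h c := by
    rcases h.eq_or_lt with rfl | h
    · exact le_rfl
    · exact (add_lt_add_left' a b c h).le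

theorem monotone_id {a b : Fin n →₀ ℕ} (h : a ≤ b) :
    (show Grevlex n from a) ≤ (show Grevlex n from b) := by
  rcases h.eq_or_lt with rfl | h'
  · exact le_rfl
  · refine le_of_lt ((lt_iff a b).2 (Or.inl ?_))
    obtain ⟨c, rfl⟩ := exists_add_of_le h
    have hc : c ≠ 0 := by rintro rfl; simp at h'
    have : c.degree ≠ 0 := by simpa [Finsupp.degree_eq_zero_iff] using hc
    rw [map_add]
    omega

instance : WellFoundedLT (Grevlex n) := by
  have : WellQuasiOrderedLE (Grevlex n) := ⟨fun u => by
    obtain ⟨i, j, hij, h⟩ :=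
      (inferInstance : WellQuasiOrderedLE (Fin n →₀ ℕ)).wqo (fun k => (u k : Fin n →₀ ℕ))
    exact ⟨i, j, hij, monotone_id h⟩⟩
  infer_instance

instance : IsOrderedCancelAddMonoid (Grevlex n) where
  le_of_add_le_add_left a b c h := by
    by_contra hlt
    have h1 := add_lt_add_left' c b a (not_le.1 hlt)
    have h2 : a + b ≤ a + c := h
    rw [add_comm a b, add_comm a c] at h2
    exact absurd h2 (not_le.2 h1)

end Grevlex

/-- The order grevlex(x) on the monomials in `x₁ ≻ ⋯ ≻ xₙ`. -/
noncomputable def grevlex (n : ℕ) : MonomialOrder (Fin n) where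
  syn := Grevlex n
  toSyn :=
    { toFun := fun a => a
      invFun := fun a => a
      left_inv := fun _ => rfl
      right_inv := fun _ => rfl
      map_add' := fun _ _ => rfl }
  toSyn_monotone _ _ h := Grevlex.monotone_id h

/-- The elimination (block) order grevlex(x) ≻ grevlex(y) on the monomials in
`x₁, …, xₙ, y₁, …, y_t`: the `x`-parts are compared by grevlex(x), ties are broken by comparing
the `y`-parts by grevlex(y). The variable `xᵢ` is `Sum.inl i` and `yⱼ` is `Sum.inr j`. -/
noncomputable def elimOrder (n t : ℕ) : MonomialOrder (Fin n ⊕ Fin t) where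
  syn := Grevlex n ×ₗ Grevlex t
  toSyn :=
    { toFun := fun a => toLex (Finsupp.sumFinsuppAddEquivProdFinsupp a)
      invFun := fun z => Finsupp.sumFinsuppAddEquivProdFinsupp.symm (ofLex z)
      left_inv := fun a => Finsupp.sumFinsuppAddEquivProdFinsupp.symm_apply_apply a
      right_inv := fun z => Finsupp.sumFinsuppAddEquivProdFinsupp.apply_symm_apply (ofLex z)
      map_add' := fun a b =>
        congrArg (toLex (α := Grevlex n × Grevlex t))
          (map_add Finsupp.sumFinsuppAddEquivProdFinsupp a b) }
  toSyn_monotone a b h := by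
    have h1 : (show Grevlex n from (Finsupp.sumFinsuppAddEquivProdFinsupp a).1) ≤
        (show Grevlex n from (Finsupp.sumFinsuppAddEquivProdFinsupp b).1) :=
      Grevlex.monotone_id fun i => h (Sum.inl i)
    have h2 : (show Grevlex t from (Finsupp.sumFinsuppAddEquivProdFinsupp a).2) ≤
        (show Grevlex t from (Finsupp.sumFinsuppAddEquivProdFinsupp b).2) :=
      Grevlex.monotone_id fun i => h (Sum.inr i)
    refine Prod.Lex.toLex_le_toLex.2 ?_
    rcases h1.eq_or_lt with h1 | h1
    · exact Or.inr ⟨h1, h2⟩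
    · exact Or.inl h1

/-! ### Gröbner bases -/

/-- The initial ideal of the set `S`: the ideal generated by the leading monomials of the nonzero
elements of `S`. -/
noncomputable def initialIdeal {σ k : Type*} [Field k] (m : MonomialOrder σ)
    (S : Set (MvPolynomial σ k)) : Ideal (MvPolynomial σ k) :=
  Ideal.span {q | ∃ p ∈ S, p ≠ 0 ∧ q = monomial (m.degree p) 1}

/-- `G` is a Gröbner basis of `I`: it generates `I`, and its leading monomials generate the
initial ideal of `I`. -/
structure IsGroebnerBasis {σ k : Type*} [Field k] (m : MonomialOrder σ)
    (I : Ideal (MvPolynomial σ k)) (G : Set (MvPolynomial σ k)) : Prop where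
  span_eq : Ideal.span G = I
  initialIdeal_eq : initialIdeal m G = initialIdeal m (I : Set (MvPolynomial σ k))

/-- `G` is the reduced Gröbner basis of `I`: a Gröbner basis of monic polynomials such that no
monomial of `g ∈ G` is divisible by the leading monomial of another element of `G`. -/
structure IsReducedGroebnerBasis {σ k : Type*} [Field k] (m : MonomialOrder σ)
    (I : Ideal (MvPolynomial σ k)) (G : Set (MvPolynomial σ k)) : Prop
    extends IsGroebnerBasis m I G where
  monic : ∀ g ∈ G, m.leadingCoeff g = 1
  reduced : ∀ g ∈ G, ∀ g' ∈ G, g' ≠ g → ∀ a ∈ g.support, ¬ m.degree g' ≤ a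

/-! ### Parametric systems -/

/-- The ring `ℚ[y, x]` with variables `x₁, …, xₙ` (`Sum.inl`) and parameters `y₁, …, y_t`
(`Sum.inr`). -/
abbrev ParamPoly (n t : ℕ) : Type := MvPolynomial (Fin n ⊕ Fin t) ℚ

/-- The field `𝕂 = ℚ(y)`. -/
abbrev RatFun (t : ℕ) : Type := FractionRing (MvPolynomial (Fin t) ℚ)

/-- The inclusion `ℚ[y, x] = ℚ[y][x] → 𝕂[x]`. -/
noncomputable def toK (n t : ℕ) : ParamPoly n t →+* MvPolynomial (Fin n) (RatFun t) :=
  (MvPolynomial.map (algebraMap (MvPolynomial (Fin t) ℚ) (RatFun t))).comp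
    (sumAlgEquiv ℚ (Fin n) (Fin t)).toRingEquiv.toRingHom

/-- The partial degree of `p` in the variables `x`. -/
noncomputable def degX {n t : ℕ} (p : ParamPoly n t) : ℕ :=
  (sumAlgEquiv ℚ (Fin n) (Fin t) p).totalDegree

/-- The homogeneous component of largest degree. -/
noncomputable def topForm {σ k : Type*} [Field k] (p : MvPolynomial σ k) : MvPolynomial σ k :=
  homogeneousComponent p.totalDegree p

/-- `f` is an affine regular sequence with respect to `x`: for every `i`, the homogeneous component
of largest degree in `x` of `fᵢ` is not a zero divisor in `𝕂[x]` modulo those of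
`f₁, …, f_{i-1}`. -/
def IsAffineRegular {n t : ℕ} (f : Fin n → ParamPoly n t) : Prop :=
  RingTheory.Sequence.IsWeaklyRegular (MvPolynomial (Fin n) (RatFun t))
    (List.ofFn fun i => topForm (toK n t (f i)))

/-- Every element of `G` has the same total degree in `(y, x)` as in `x` alone. -/
def AssumptionE {n t : ℕ} (G : Set (ParamPoly n t)) : Prop :=
  ∀ g ∈ G, g.totalDegree = degX g

/-- The ideal `⟨f⟩_𝕂` generated by `f` in `𝕂[x]`. -/
noncomputable def idealK {n t : ℕ} (f : Fin n → ParamPoly n t) :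
    Ideal (MvPolynomial (Fin n) (RatFun t)) :=
  Ideal.span (Set.range fun i => toK n t (f i))

/-- The quotient `A_𝕂 = 𝕂[x] / ⟨f⟩_𝕂`. -/
abbrev quotK {n t : ℕ} (f : Fin n → ParamPoly n t) : Type :=
  MvPolynomial (Fin n) (RatFun t) ⧸ idealK f

/-- The class in `A_𝕂` of the monomial in `x` with exponent `b`. -/
noncomputable def monoClass {n t : ℕ} (f : Fin n → ParamPoly n t) (b : Fin n →₀ ℕ) : quotK f :=
  Ideal.Quotient.mk (idealK f) (monomial b 1)

/-- The (exponents of the) monomials in `x` that are not reducible by `G`, that is, not divisible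
by the leading monomial with respect to grevlex(x) of an element of `G`, viewed in `𝕂[x]`. -/
def basisB {n t : ℕ} (G : Set (ParamPoly n t)) : Set (Fin n →₀ ℕ) :=
  {b | ∀ g ∈ G, ¬ (grevlex n).degree (toK n t g) ≤ b}

/-- The parametric Hermite matrix of `f` with respect to a set `B` of monomials: the entry at
`(b, b')` is the trace of the multiplication by `b * b'` on `A_𝕂`. -/
noncomputable def hermiteMatrix {n t : ℕ} (f : Fin n → ParamPoly n t) (B : Set (Fin n →₀ ℕ)) :
    Matrix B B (RatFun t) :=
  Matrix.of fun b b' => Algebra.trace (RatFun t) (quotK f) (monoClass f b * monoClass f b')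

/-- The element `h` of `ℚ(y)` is a polynomial in `ℚ[y]` of total degree at most `D`. -/
def IsPolyOfDegreeLE {t : ℕ} (h : RatFun t) (D : ℕ) : Prop :=
  ∃ p : MvPolynomial (Fin t) ℚ,
    algebraMap (MvPolynomial (Fin t) ℚ) (RatFun t) p = h ∧ p.totalDegree ≤ D

end ParamHermite

/-!
Let `H i` be the form of largest degree of `f i` in `𝕂[x]`. Adding to a homogeneous ideal a form of
degree `e` that is not a zero divisor modulo the ideal multiplies the Hilbert series by `1 - X ^ e`
(`hilbertSeries_sup_span_singleton`). Hence the Hilbert series of `𝕂[x] / (H 1, …, H n)` is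
`∏ (1 + X + ⋯ + X ^ (e i - 1))` with `e i = deg (H i) ≤ d` (`hilbertSeries_ofFn`). This also holds
when some `H i` is constant, both sides being `0`.

Leading monomials for the elimination order restrict to leading monomials for grevlex over `ℚ(y)`
(`grevlex_degree_toK`), and denominators of elements of `⟨f⟩_𝕂` can be cleared, so the monomials in
`basisB G` are those that are not leading monomials of elements of `⟨f⟩_𝕂`. They form a basis of the
quotient (`exists_basis`). Since grevlex is graded, those of degree `k` are independent modulo the
`H i` (`eq_zero_of_mem_span_topForm`). Their number is therefore at most the coefficient of `X ^ k`
in the polynomial above; its degree and its derivative at `1` give the bounds on the degrees of the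
basis monomials and on their sum (`degree_bounds_basisB`). Only this inequality of Hilbert functions
is needed.

Under `AssumptionE G` every element of `G` is monic in `x` and has its total degree in `x` alone, so
that division by `G` takes place over `ℚ[y]` and does not increase the total degree in `(y, x)`: the
coordinate of `x ^ a` at the basis monomial `b` is a polynomial of degree at most `deg a - deg b`
(`repr_monoClass_isPolyOfDegreeAddLE`). The trace at `(b, b')` then has degree at most
`deg b + deg b'`, and the Leibniz formula bounds the minors by twice the sum of the degrees of the
basis monomials (`minor_hermiteMatrix_isPolyOfDegreeLE`).
-/

open MvPolynomial

namespace ParamHermite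

/-! ### Hilbert series of homogeneous ideals -/

section HilbertSeries

variable {σ K : Type*} [Field K]

theorem homogeneousComponent_mul_of_isHomogeneous {h : MvPolynomial σ K} {e : ℕ}
    (hh : h.IsHomogeneous e) (k : ℕ) (q : MvPolynomial σ K) :
    homogeneousComponent k (q * h) =
      if e ≤ k then homogeneousComponent (k - e) q * h else 0 := by
  induction q using MvPolynomial.induction_on' with
  | monomial a c =>
    rw [homogeneousComponent_of_mem ((isHomogeneous_monomial c rfl).mul hh),
      homogeneousComponent_of_mem (isHomogeneous_monomial c rfl)]
    by_cases h1 : k = a.degree + e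
    · subst h1; simp
    · rw [if_neg h1]
      split_ifs with h2 h3
      · omega
      · simp
      · rfl
  | add p q hp hq =>
    rw [add_mul, map_add, hp, hq, map_add]
    split_ifs <;> ring

/-- The homogeneous elements of degree `k` of the ideal `J`. -/
noncomputable def gradedPart (J : Ideal (MvPolynomial σ K)) (k : ℕ) :
    Submodule K (MvPolynomial σ K) :=
  J.restrictScalars K ⊓ homogeneousSubmodule σ K k

theorem mem_gradedPart {J : Ideal (MvPolynomial σ K)} {k : ℕ} {p : MvPolynomial σ K} :
    p ∈ gradedPart J k ↔ p ∈ J ∧ p.IsHomogeneous k := Iff.rfl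

/-- The property of `J` of containing the homogeneous components of its elements. -/
def IsHomogeneousIdeal (J : Ideal (MvPolynomial σ K)) : Prop :=
  ∀ p ∈ J, ∀ k, homogeneousComponent k p ∈ J

theorem IsHomogeneousIdeal.sup_span_singleton {J : Ideal (MvPolynomial σ K)}
    (hJ : IsHomogeneousIdeal J) {h : MvPolynomial σ K} {e : ℕ} (hh : h.IsHomogeneous e) :
    IsHomogeneousIdeal (J ⊔ Ideal.span {h}) := by
  intro p hp k
  obtain ⟨a, ha, b, hb, rfl⟩ := Submodule.mem_sup.1 hp
  obtain ⟨q, rfl⟩ := Ideal.mem_span_singleton'.1 hb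
  rw [map_add, homogeneousComponent_mul_of_isHomogeneous hh]
  refine add_mem (Ideal.mem_sup_left (hJ a ha k)) ?_
  split_ifs
  · exact Ideal.mem_sup_right (Ideal.mul_mem_left _ _ (Ideal.mem_span_singleton_self h))
  · exact zero_mem _

theorem gradedPart_sup_of_lt {J : Ideal (MvPolynomial σ K)} (hJ : IsHomogeneousIdeal J)
    {h : MvPolynomial σ K} {e : ℕ} (hh : h.IsHomogeneous e) {k : ℕ} (hk : k < e) :
    gradedPart (J ⊔ Ideal.span {h}) k = gradedPart J k := by
  ext p
  rw [mem_gradedPart, mem_gradedPart]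
  refine ⟨fun ⟨hp, hpk⟩ => ⟨?_, hpk⟩, fun ⟨hp, hpk⟩ => ⟨Ideal.mem_sup_left hp, hpk⟩⟩
  obtain ⟨a, ha, b, hb, rfl⟩ := Submodule.mem_sup.1 hp
  obtain ⟨q, rfl⟩ := Ideal.mem_span_singleton'.1 hb
  have h1 := hJ a ha k
  have h2 := homogeneousComponent_eq_self hpk
  rw [map_add, homogeneousComponent_mul_of_isHomogeneous hh, if_neg (by omega), add_zero] at h2
  rwa [h2] at h1

theorem mem_gradedPart_sup {J : Ideal (MvPolynomial σ K)} (hJ : IsHomogeneousIdeal J)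
    {h : MvPolynomial σ K} {e : ℕ} (hh : h.IsHomogeneous e) {k : ℕ} (hk : e ≤ k)
    {p : MvPolynomial σ K} :
    p ∈ gradedPart (J ⊔ Ideal.span {h}) k ↔
      ∃ a ∈ gradedPart J k, ∃ q ∈ homogeneousSubmodule σ K (k - e), a + q * h = p := by
  constructor
  · rintro ⟨hp, hpk⟩
    obtain ⟨a, ha, b, hb, rfl⟩ := Submodule.mem_sup.1 hp
    obtain ⟨q, rfl⟩ := Ideal.mem_span_singleton'.1 hb
    have h2 := homogeneousComponent_eq_self hpk
    rw [map_add, homogeneousComponent_mul_of_isHomogeneous hh, if_pos hk] at h2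
    exact ⟨_, ⟨hJ a ha k, homogeneousComponent_isHomogeneous k a⟩, _,
      homogeneousComponent_isHomogeneous (k - e) q, h2⟩
  · rintro ⟨a, ⟨ha, hak⟩, q, hq, rfl⟩
    refine ⟨add_mem (Ideal.mem_sup_left ha)
      (Ideal.mem_sup_right (Ideal.mul_mem_left _ _ (Ideal.mem_span_singleton_self h))), ?_⟩
    have := hak.add (by simpa [Nat.sub_add_cancel hk] using hq.mul hh)
    exact this

variable [Finite σ]

instance (k : ℕ) : FiniteDimensional K (homogeneousSubmodule σ K k) :=
  Module.Finite.iff_fg.2 (homogeneousSubmodule_fg σ K k)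

instance (J : Ideal (MvPolynomial σ K)) (k : ℕ) : FiniteDimensional K (gradedPart J k) :=
  Submodule.finiteDimensional_of_le (inf_le_right : gradedPart J k ≤ homogeneousSubmodule σ K k)

/-- Multiplication by `h` is injective modulo `J`, so the kernel of `(a, q) ↦ a + q * h` is a copy
of the degree `k - e` part of `J`; the formula is the rank-nullity theorem for this map. -/
theorem finrank_gradedPart_sup {J : Ideal (MvPolynomial σ K)} (hJ : IsHomogeneousIdeal J)
    {h : MvPolynomial σ K} {e : ℕ} (hh : h.IsHomogeneous e)
    (hreg : ∀ q, q * h ∈ J → q ∈ J) {k : ℕ} (hk : e ≤ k) :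
    Module.finrank K (gradedPart (J ⊔ Ideal.span {h}) k) +
        Module.finrank K (gradedPart J (k - e)) =
      Module.finrank K (gradedPart J k) +
        Module.finrank K (homogeneousSubmodule σ K (k - e)) := by
  let ψ : gradedPart J k × homogeneousSubmodule σ K (k - e) →ₗ[K] MvPolynomial σ K :=
    (gradedPart J k).subtype.coprod
      ((LinearMap.mulRight K h).comp (homogeneousSubmodule σ K (k - e)).subtype)
  have hψ : ∀ a q, ψ (a, q) = a.1 + q.1 * h := fun a q => rfl
  have hrange : LinearMap.range ψ = gradedPart (J ⊔ Ideal.span {h}) k := by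
    ext p
    rw [mem_gradedPart_sup hJ hh hk, LinearMap.mem_range]
    constructor
    · rintro ⟨⟨a, q⟩, rfl⟩
      exact ⟨a, a.2, q, q.2, rfl⟩
    · rintro ⟨a, ha, q, hq, rfl⟩
      exact ⟨(⟨a, ha⟩, ⟨q, hq⟩), rfl⟩
  let χ : LinearMap.ker ψ →ₗ[K] MvPolynomial σ K :=
    ((homogeneousSubmodule σ K (k - e)).subtype.comp (LinearMap.snd K _ _)).comp
      (LinearMap.ker ψ).subtype
  have hχ : Function.Injective χ := by
    rintro ⟨⟨a, q⟩, hz⟩ ⟨⟨a', q'⟩, hz'⟩ h0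
    have hq : q = q' := Subtype.ext h0
    subst hq
    rw [LinearMap.mem_ker, hψ] at hz hz'
    have ha : a = a' := Subtype.ext (add_right_cancel (hz.trans hz'.symm))
    subst ha
    rfl
  have hχrange : LinearMap.range χ = gradedPart J (k - e) := by
    ext p
    rw [LinearMap.mem_range]
    constructor
    · rintro ⟨⟨⟨a, q⟩, hz⟩, rfl⟩
      rw [LinearMap.mem_ker, hψ] at hz
      refine ⟨hreg _ ?_, q.2⟩
      change q.1 * h ∈ J
      rw [eq_neg_of_add_eq_zero_right hz]
      exact neg_mem a.2.1
    · rintro ⟨hp, hpk⟩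
      have hph : (p * h).IsHomogeneous k := by
        simpa [Nat.sub_add_cancel hk] using IsHomogeneous.mul hpk hh
      refine ⟨⟨(⟨-(p * h), neg_mem (Ideal.mul_mem_right _ _ hp), hph.neg⟩, ⟨p, hpk⟩), ?_⟩, rfl⟩
      rw [LinearMap.mem_ker, hψ]
      simp
  have h1 := LinearMap.finrank_range_add_finrank_ker ψ
  rw [hrange, Module.finrank_prod, ← LinearMap.finrank_range_of_inj hχ, hχrange] at h1
  exact h1

/-- The Hilbert series of the quotient by the homogeneous ideal `J`. -/
noncomputable def hilbertSeries (J : Ideal (MvPolynomial σ K)) : PowerSeries ℤ :=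
  PowerSeries.mk fun k => (Module.finrank K (homogeneousSubmodule σ K k) : ℤ) -
    Module.finrank K (gradedPart J k)

/-- The power series form of `finrank_gradedPart_sup`. The case `e = 0` is included: there `h` is a
nonzero constant or `J` is the unit ideal, and both sides vanish. -/
theorem hilbertSeries_sup_span_singleton {J : Ideal (MvPolynomial σ K)}
    (hJ : IsHomogeneousIdeal J) {h : MvPolynomial σ K} {e : ℕ} (hh : h.IsHomogeneous e)
    (hreg : ∀ q, q * h ∈ J → q ∈ J) :
    hilbertSeries (J ⊔ Ideal.span {h}) = hilbertSeries J * (1 - PowerSeries.X ^ e) := by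
  ext k
  rw [mul_sub, mul_one, map_sub, PowerSeries.coeff_mul_X_pow']
  simp only [hilbertSeries, PowerSeries.coeff_mk]
  split_ifs with hk
  · have := finrank_gradedPart_sup hJ hh hreg hk
    push_cast [← @Nat.cast_inj ℤ] at this
    linarith
  · rw [gradedPart_sup_of_lt hJ hh (by omega), sub_zero]

theorem hilbertSeries_of_isWeaklyRegular (rs : List (MvPolynomial σ K))
    (hrs : RingTheory.Sequence.IsWeaklyRegular (MvPolynomial σ K) rs)
    (hh : ∀ h ∈ rs, h.IsHomogeneous h.totalDegree) :
    IsHomogeneousIdeal (Ideal.ofList rs) ∧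
    hilbertSeries (Ideal.ofList rs) = hilbertSeries (⊥ : Ideal (MvPolynomial σ K)) *
      (rs.map fun h => (1 - PowerSeries.X ^ h.totalDegree : PowerSeries ℤ)).prod := by
  induction rs using List.reverseRecOn with
  | nil =>
    refine ⟨fun p hp k => ?_, by simp⟩
    rw [Ideal.ofList_nil, Ideal.mem_bot] at hp ⊢
    simp [hp]
  | append_singleton rs h ih =>
    rw [RingTheory.Sequence.isWeaklyRegular_append_iff,
      RingTheory.Sequence.isWeaklyRegular_singleton_iff] at hrs
    obtain ⟨ih1, ih2⟩ := ih hrs.1 fun x hx => hh x (by simp [hx])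
    have hhom := hh h (by simp)
    have hreg : ∀ q, q * h ∈ Ideal.ofList rs → q ∈ Ideal.ofList rs := by
      intro q hq
      have h1 := hrs.2.right_eq_zero_of_smul (x := Submodule.Quotient.mk q)
      rw [← Submodule.Quotient.mk_smul, Submodule.Quotient.mk_eq_zero,
        Submodule.Quotient.mk_eq_zero] at h1
      simpa [mul_comm h q, hq] using h1
    rw [Ideal.ofList_append, Ideal.ofList_singleton]
    refine ⟨ih1.sup_span_singleton hhom, ?_⟩
    rw [hilbertSeries_sup_span_singleton ih1 hhom hreg, ih2]
    simp [mul_assoc]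

end HilbertSeries

/-! ### Complete intersections and degree counts -/

section Counting

variable {K : Type*} [Field K] {n : ℕ}

theorem finite_degree_eq (n k : ℕ) : {a : Fin n →₀ ℕ | a.degree = k}.Finite :=
  (Finset.finsuppAntidiag Finset.univ k).finite_toSet.subset fun a ha => by
    simpa [Finsupp.degree_eq_sum] using ha

theorem ncard_degree_eq (n k : ℕ) :
    {a : Fin n →₀ ℕ | a.degree = k}.ncard = (n + k - 1).choose k := by
  have h : {a : Fin n →₀ ℕ | a.degree = k} =
      (Finset.finsuppAntidiag (Finset.univ : Finset (Fin n)) k : Set (Fin n →₀ ℕ)) := by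
    ext a
    simp [Finsupp.degree_eq_sum]
  rw [h, Set.ncard_coe_finset, Finset.card_finsuppAntidiag_nat_eq_choose]
  simp

theorem homogeneousSubmodule_eq_restrictSupport {σ : Type*} (k : ℕ) :
    homogeneousSubmodule σ K k = restrictSupport K {a | a.degree = k} := by
  ext p
  rw [mem_restrictSupport_iff]
  constructor
  · intro h a ha
    by_contra hne
    exact (mem_support_iff.1 ha) (h.coeff_eq_zero hne)
  · intro h a ha
    have := h (mem_support_iff.2 ha)
    rw [← this, Finsupp.degree_eq_weight_one]
    rfl

theorem finrank_restrictSupport {σ : Type*} (s : Set (σ →₀ ℕ)) :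
    Module.finrank K (restrictSupport K s) = s.ncard := by
  rw [Module.finrank_eq_nat_card_basis (basisRestrictSupport K s), Nat.card_coe_set_eq]

/-- The Hilbert series of the polynomial ring in `n` variables is `1 / (1 - X) ^ n`. -/
theorem hilbertSeries_bot_mul :
    hilbertSeries (⊥ : Ideal (MvPolynomial (Fin n) K)) * (1 - PowerSeries.X) ^ n = 1 := by
  have h : hilbertSeries (⊥ : Ideal (MvPolynomial (Fin n) K)) =
      (PowerSeries.invOneSubPow ℤ n).val := by
    ext k
    have h0 : gradedPart (⊥ : Ideal (MvPolynomial (Fin n) K)) k = ⊥ := by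
      rw [eq_bot_iff]
      exact fun p hp => hp.1
    rw [hilbertSeries, PowerSeries.coeff_mk, h0, finrank_bot,
      homogeneousSubmodule_eq_restrictSupport, finrank_restrictSupport, ncard_degree_eq]
    rcases n with _ | n
    · rw [PowerSeries.invOneSubPow_zero]
      rcases k with _ | k
      · simp
      · simp [PowerSeries.coeff_one]
    · rw [PowerSeries.invOneSubPow_val_succ_eq_mk_add_choose, PowerSeries.coeff_mk]
      have : n + 1 + k - 1 = n + k := by omega
      rw [this, Nat.choose_symm_add]
      simp
  rw [h, ← PowerSeries.invOneSubPow_inv_eq_one_sub_pow, Units.val_inv]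

/-- The Hilbert series of a complete intersection of degrees `e i`, as a polynomial. -/
noncomputable def completeIntersectionPoly (e : Fin n → ℕ) : Polynomial ℤ :=
  ∏ i, ∑ j ∈ Finset.range (e i), Polynomial.X ^ j

/-- Both sides agree after multiplication by `(1 - X) ^ n`, which is invertible. -/
theorem hilbertSeries_ofFn (H : Fin n → MvPolynomial (Fin n) K)
    (hreg : RingTheory.Sequence.IsWeaklyRegular (MvPolynomial (Fin n) K) (List.ofFn H))
    (hH : ∀ i, (H i).IsHomogeneous (H i).totalDegree) :
    hilbertSeries (Ideal.span (Set.range H)) =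
      (completeIntersectionPoly fun i => (H i).totalDegree : Polynomial ℤ) := by
  have h1 := (hilbertSeries_of_isWeaklyRegular _ hreg (by simpa [List.mem_ofFn] using hH)).2
  have h2 : Ideal.ofList (List.ofFn H) = Ideal.span (Set.range H) := by
    rw [Ideal.ofList]
    congr 1
    ext p
    simp [List.mem_ofFn]
  rw [h2, List.map_ofFn, List.prod_ofFn] at h1
  have h3 : ∏ i, ((fun h : MvPolynomial (Fin n) K =>
        (1 - PowerSeries.X ^ h.totalDegree : PowerSeries ℤ)) ∘ H) i =
      ((completeIntersectionPoly fun i => (H i).totalDegree : Polynomial ℤ) : PowerSeries ℤ) *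
        (1 - PowerSeries.X : PowerSeries ℤ) ^ n := by
    rw [completeIntersectionPoly]
    have : (1 - PowerSeries.X : PowerSeries ℤ) ^ n =
        ∏ _i : Fin n, (1 - PowerSeries.X : PowerSeries ℤ) := by simp
    rw [this, ← Polynomial.coeToPowerSeries.ringHom_apply, map_prod, ← Finset.prod_mul_distrib]
    refine Finset.prod_congr rfl fun i _ => ?_
    rw [map_sum]
    simp only [map_pow, Polynomial.coeToPowerSeries.ringHom_apply, Polynomial.coe_X]
    exact (geom_sum_mul_neg _ _).symm
  rw [h1, h3, mul_comm, mul_assoc, mul_comm _ (hilbertSeries _), hilbertSeries_bot_mul, mul_one]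

/-- Monomials of degree `k` that are linearly independent modulo `J` are at most as many as the
value of the Hilbert function of `J` at `k`. -/
theorem ncard_le_coeff_hilbertSeries (J : Ideal (MvPolynomial (Fin n) K)) (k : ℕ)
    (S : Set (Fin n →₀ ℕ)) (hS : ∀ a ∈ S, a.degree = k)
    (hJ : ∀ p ∈ J, (p.support : Set (Fin n →₀ ℕ)) ⊆ S → p = 0) :
    (S.ncard : ℤ) ≤ PowerSeries.coeff k (hilbertSeries J) := by
  have hle : restrictSupport K S ≤ homogeneousSubmodule (Fin n) K k := by
    rw [homogeneousSubmodule_eq_restrictSupport]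
    exact restrictSupport_mono K hS
  have : FiniteDimensional K (restrictSupport K S) := Submodule.finiteDimensional_of_le hle
  have h1 := Submodule.finrank_sup_add_finrank_inf_eq (restrictSupport K S) (gradedPart J k)
  have h2 : restrictSupport K S ⊓ gradedPart J k = ⊥ := by
    rw [eq_bot_iff]
    rintro p ⟨hp1, hp2⟩
    exact hJ p hp2.1 ((mem_restrictSupport_iff K).1 hp1)
  have h3 : restrictSupport K S ⊔ gradedPart J k ≤ homogeneousSubmodule (Fin n) K k :=
    sup_le hle inf_le_right
  have h4 := Submodule.finrank_mono h3
  rw [h2, finrank_bot, finrank_restrictSupport] at h1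
  rw [hilbertSeries, PowerSeries.coeff_mk]
  omega

theorem natDegree_completeIntersectionPoly_le {e : Fin n → ℕ} {d : ℕ} (he : ∀ i, e i ≤ d) :
    (completeIntersectionPoly e).natDegree ≤ n * (d - 1) := by
  refine (Polynomial.natDegree_prod_le _ _).trans ?_
  refine (Finset.sum_le_card_nsmul _ _ (d - 1) fun i _ => ?_).trans (by simp)
  refine Polynomial.natDegree_sum_le_of_forall_le _ _ fun j hj => ?_
  have := Finset.mem_range.1 hj
  have := he i
  rw [Polynomial.natDegree_X_pow]
  omega

/-- The term of the product rule at `i` is `∏ e j` over `j ≠ i` times `0 + 1 + ⋯ + (e i - 1)`. -/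
theorem two_mul_eval_derivative_completeIntersectionPoly_le {e : Fin n → ℕ} {d : ℕ}
    (he : ∀ i, e i ≤ d) :
    2 * (Polynomial.derivative (completeIntersectionPoly e)).eval 1 ≤
      ((n * (d - 1) * d ^ n : ℕ) : ℤ) := by
  rw [completeIntersectionPoly, Polynomial.derivative_prod_finset, Polynomial.eval_finsetSum,
    Finset.mul_sum]
  have key : ∀ i ∈ (Finset.univ : Finset (Fin n)),
      2 * Polynomial.eval 1 ((∏ j ∈ Finset.univ.erase i,
        ∑ k ∈ Finset.range (e j), (Polynomial.X : Polynomial ℤ) ^ k) *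
          Polynomial.derivative (∑ k ∈ Finset.range (e i), Polynomial.X ^ k)) ≤
        (((d - 1) * d ^ n : ℕ) : ℤ) := by
    intro i _
    have hgauss : (∑ k ∈ Finset.range (e i), (k : ℤ)) * 2 = ((e i * (e i - 1) : ℕ) : ℤ) := by
      rw [← Finset.sum_range_id_mul_two (e i)]
      push_cast
      rfl
    have hprod : (∏ j ∈ Finset.univ.erase i, (e j : ℤ)) * 2 * (∑ k ∈ Finset.range (e i), (k : ℤ))
        = (((∏ j, e j) * (e i - 1) : ℕ) : ℤ) := by
      rw [mul_assoc, mul_comm 2, hgauss, ← Finset.mul_prod_erase _ _ (Finset.mem_univ i)]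
      push_cast
      ring
    have hbound : (∏ j, e j) * (e i - 1) ≤ (d - 1) * d ^ n := by
      rw [mul_comm]
      refine Nat.mul_le_mul (Nat.sub_le_sub_right (he i) 1) ?_
      exact (Finset.prod_le_pow_card _ _ d fun j _ => he j).trans (by simp)
    rw [Polynomial.eval_mul, Polynomial.eval_prod, Polynomial.derivative_sum]
    simp only [Polynomial.eval_finsetSum, Polynomial.derivative_X_pow, Polynomial.eval_mul,
      Polynomial.eval_pow, Polynomial.eval_X, one_pow, mul_one, Finset.sum_const,
      Finset.card_range, nsmul_eq_mul, Polynomial.eval_natCast, map_natCast]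
    rw [← mul_assoc, mul_comm 2, hprod]
    exact_mod_cast hbound
  refine (Finset.sum_le_card_nsmul _ _ _ key).trans ?_
  simp [mul_assoc]

/-- A set of exponents with at most `P.coeff k` elements of every degree `k` is finite, its degrees
are at most that of `P`, and the sum of the degrees is at most the derivative of `P` at `1`. -/
theorem degree_bounds_of_ncard_le (B : Set (Fin n →₀ ℕ)) (P : Polynomial ℤ)
    (h : ∀ k, (({b ∈ B | b.degree = k}.ncard : ℕ) : ℤ) ≤ P.coeff k) :
    (∀ b ∈ B, b.degree ≤ P.natDegree) ∧
      ∃ hfin : B.Finite, ((∑ b ∈ hfin.toFinset, b.degree : ℕ) : ℤ) ≤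
        (Polynomial.derivative P).eval 1 := by
  have hdeg : ∀ b ∈ B, b.degree ≤ P.natDegree := by
    intro b hb
    refine Polynomial.le_natDegree_of_ne_zero fun h0 => ?_
    have h1 := h b.degree
    rw [h0] at h1
    have hfin : {c ∈ B | c.degree = b.degree}.Finite :=
      (finite_degree_eq n b.degree).subset fun c hc => hc.2
    have h2 : 0 < {c ∈ B | c.degree = b.degree}.ncard :=
      (Set.ncard_pos hfin).2 ⟨b, hb, rfl⟩
    omega
  have hfin : B.Finite := by
    refine ((Set.finite_Iic P.natDegree).biUnion fun k _ => finite_degree_eq n k).subset ?_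
    intro b hb
    simp only [Set.mem_iUnion]
    exact ⟨b.degree, hdeg b hb, rfl⟩
  refine ⟨hdeg, hfin, ?_⟩
  rw [Polynomial.derivative_eval, Polynomial.sum_over_range _ (by simp)]
  have hmaps : ∀ b ∈ hfin.toFinset, b.degree ∈ Finset.range (P.natDegree + 1) := by
    intro b hb
    have := hdeg b (hfin.mem_toFinset.1 hb)
    simp only [Finset.mem_range]
    omega
  rw [← Finset.sum_fiberwise_of_maps_to hmaps, Nat.cast_sum]
  refine Finset.sum_le_sum fun k _ => ?_
  rw [Finset.sum_congr rfl fun b hb => (Finset.mem_filter.1 hb).2, Finset.sum_const, smul_eq_mul,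
    one_pow, mul_one, Nat.cast_mul]
  refine mul_le_mul_of_nonneg_right ?_ (Nat.cast_nonneg _)
  refine le_trans (le_of_eq ?_) (h k)
  rw [← Set.ncard_coe_finset]
  congr 2
  ext b
  simp

end Counting

/-! ### Leading monomials over `ℚ(y)` -/

section Elimination

variable {n t : ℕ}

theorem grevlex_le_iff {a b : Fin n →₀ ℕ} :
    (grevlex n).toSyn a ≤ (grevlex n).toSyn b ↔ (show Grevlex n from a) ≤ (show Grevlex n from b) :=
  Iff.rfl

theorem degree_le_of_grevlex_le {a b : Fin n →₀ ℕ}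
    (h : (grevlex n).toSyn a ≤ (grevlex n).toSyn b) : a.degree ≤ b.degree := by
  by_contra hlt
  exact absurd (grevlex_le_iff.1 h) (not_le.2 ((Grevlex.lt_iff b a).2 (Or.inl (not_le.1 hlt))))

theorem degree_grevlex_degree {R : Type*} [CommSemiring R] (p : MvPolynomial (Fin n) R) :
    ((grevlex n).degree p).degree = p.totalDegree := by
  by_cases hp : p = 0
  · simp [hp]
  · refine le_antisymm (le_totalDegree ((grevlex n).degree_mem_support hp)) ?_
    exact Finset.sup_le fun a ha => degree_le_of_grevlex_le ((grevlex n).le_degree ha)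

theorem coeff_coeff_sumAlgEquiv (p : ParamPoly n t) (a : Fin n →₀ ℕ) (c : Fin t →₀ ℕ) :
    coeff c (coeff a (sumAlgEquiv ℚ (Fin n) (Fin t) p)) = coeff (Finsupp.sumElim a c) p := by
  induction p using MvPolynomial.induction_on' with
  | monomial e r =>
    have : sumAlgEquiv ℚ (Fin n) (Fin t) (monomial e r) =
      monomial (Finsupp.sumFinsuppAddEquivProdFinsupp e).1
        (monomial (Finsupp.sumFinsuppAddEquivProdFinsupp e).2 r) := by
      simp [sumAlgEquiv, monomial]
    have he : e = Finsupp.sumElim a c ↔ (Finsupp.sumFinsuppAddEquivProdFinsupp e).1 = a ∧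
        (Finsupp.sumFinsuppAddEquivProdFinsupp e).2 = c := by
      constructor
      · rintro rfl
        exact ⟨by ext i; simp, by ext i; simp⟩
      · rintro ⟨rfl, rfl⟩
        ext (i | i) <;> simp
    rw [this, coeff_monomial, coeff_monomial]
    split_ifs with h1 h2 h2
    · rw [coeff_monomial, if_pos (he.1 h2).2]
    · rw [coeff_monomial, if_neg fun h => h2 (he.2 ⟨h1, h⟩)]
    · exact absurd (he.1 h2).1 h1
    · rfl
  | add p q hp hq => simp [hp, hq]

theorem coeff_toK (p : ParamPoly n t) (a : Fin n →₀ ℕ) :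
    coeff a (toK n t p) = algebraMap (MvPolynomial (Fin t) ℚ) (RatFun t)
      (coeff a (sumAlgEquiv ℚ (Fin n) (Fin t) p)) := by
  exact coeff_map _ _ _

theorem toK_injective : Function.Injective (toK n t) :=
  (map_injective _ (IsFractionRing.injective _ _)).comp (sumAlgEquiv ℚ (Fin n) (Fin t)).injective

theorem toK_ne_zero {p : ParamPoly n t} (hp : p ≠ 0) : toK n t p ≠ 0 :=
  (map_ne_zero_iff _ toK_injective).2 hp

theorem support_toK (p : ParamPoly n t) :
    (toK n t p).support = (sumAlgEquiv ℚ (Fin n) (Fin t) p).support :=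
  support_map_of_injective _ (IsFractionRing.injective _ _)

theorem totalDegree_toK (p : ParamPoly n t) : (toK n t p).totalDegree = degX p := by
  rw [degX, totalDegree, totalDegree, support_toK]

theorem sumElim_sumFinsuppAddEquivProdFinsupp (e : Fin n ⊕ Fin t →₀ ℕ) :
    Finsupp.sumElim (Finsupp.sumFinsuppAddEquivProdFinsupp e).1
      (Finsupp.sumFinsuppAddEquivProdFinsupp e).2 = e := by
  ext (i | i) <;> simp

theorem degree_sumElim (a : Fin n →₀ ℕ) (c : Fin t →₀ ℕ) :
    (Finsupp.sumElim a c).degree = a.degree + c.degree := by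
  simp [Finsupp.degree_eq_sum]

theorem totalDegree_coeff_add_le (p : ParamPoly n t) {a : Fin n →₀ ℕ}
    (ha : coeff a (sumAlgEquiv ℚ (Fin n) (Fin t) p) ≠ 0) :
    (coeff a (sumAlgEquiv ℚ (Fin n) (Fin t) p)).totalDegree + a.degree ≤ p.totalDegree := by
  obtain ⟨c, hc, hdeg⟩ := Finset.exists_mem_eq_sup _ (support_nonempty.2 ha)
    (fun c : Fin t →₀ ℕ => c.sum fun _ e => e)
  have h1 : Finsupp.sumElim a c ∈ p.support := by
    rw [mem_support_iff, ← coeff_coeff_sumAlgEquiv]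
    exact mem_support_iff.1 hc
  have h2 : (Finsupp.sumElim a c).degree ≤ p.totalDegree := le_totalDegree h1
  rw [degree_sumElim] at h2
  have h3 : (coeff a (sumAlgEquiv ℚ (Fin n) (Fin t) p)).totalDegree = c.degree := hdeg
  omega

theorem degX_le_totalDegree (p : ParamPoly n t) : degX p ≤ p.totalDegree := by
  by_cases hp : p = 0
  · simp [hp, degX]
  · rw [← totalDegree_toK, ← degree_grevlex_degree]
    refine le_trans (Nat.le_add_left _ _) (totalDegree_coeff_add_le p (a := _) ?_)
    rw [← mem_support_iff, ← support_toK]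
    exact (grevlex n).degree_mem_support (toK_ne_zero hp)

/-- The elimination order compares `x`-parts first, so the `x`-part of the leading monomial is the
leading monomial over `ℚ(y)`. -/
theorem grevlex_degree_toK {p : ParamPoly n t} (hp : p ≠ 0) :
    (grevlex n).degree (toK n t p) =
      (Finsupp.sumFinsuppAddEquivProdFinsupp ((elimOrder n t).degree p)).1 := by
  set e := (elimOrder n t).degree p with he
  refine (grevlex n).toSyn.injective (le_antisymm ?_ ?_)
  · rw [(grevlex n).degree_le_iff]
    intro a ha
    rw [support_toK, mem_support_iff] at ha
    obtain ⟨c, hc⟩ := ne_zero_iff.1 ha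
    rw [coeff_coeff_sumAlgEquiv, ← mem_support_iff] at hc
    have h1 := (elimOrder n t).le_degree hc
    rw [← he] at h1
    have h2 := (Prod.Lex.monotone_fst (α := Grevlex n) (β := Grevlex t)) _ _ h1
    have h3 : (Finsupp.sumFinsuppAddEquivProdFinsupp (Finsupp.sumElim a c)).1 = a := by
      ext i; simp
    change (show Grevlex n from a) ≤ _
    refine le_trans (le_of_eq h3.symm) h2
  · refine (grevlex n).le_degree ?_
    rw [support_toK, mem_support_iff]
    refine ne_zero_iff.2 ⟨(Finsupp.sumFinsuppAddEquivProdFinsupp e).2, ?_⟩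
    rw [coeff_coeff_sumAlgEquiv, sumElim_sumFinsuppAddEquivProdFinsupp, ← mem_support_iff]
    exact (elimOrder n t).degree_mem_support hp

theorem idealK_eq_map (f : Fin n → ParamPoly n t) :
    idealK f = (Ideal.span (Set.range f)).map (toK n t) := by
  rw [Ideal.map_span, idealK, ← Set.range_comp]
  rfl

theorem toK_mem_idealK {f : Fin n → ParamPoly n t} {q : ParamPoly n t}
    (hq : q ∈ Ideal.span (Set.range f)) : toK n t q ∈ idealK f := by
  rw [idealK_eq_map]
  exact Ideal.mem_map_of_mem _ hq

/-- Elements of `⟨f⟩_𝕂` come from elements of `⟨f⟩` after clearing denominators. -/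
theorem exists_toK_eq_of_mem_idealK {f : Fin n → ParamPoly n t}
    {p : MvPolynomial (Fin n) (RatFun t)} (hp : p ∈ idealK f) :
    ∃ s : RatFun t, s ≠ 0 ∧ ∃ q ∈ Ideal.span (Set.range f), toK n t q = C s * p := by
  let : Algebra (MvPolynomial (Fin n) (MvPolynomial (Fin t) ℚ))
    (MvPolynomial (Fin n) (RatFun t)) := algebraMvPolynomial
  have hloc := MvPolynomial.isLocalization (σ := Fin n)
    (nonZeroDivisors (MvPolynomial (Fin t) ℚ)) (RatFun t)
  have h1 : idealK f = ((Ideal.span (Set.range f)).map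
      (sumAlgEquiv ℚ (Fin n) (Fin t)).toRingEquiv).map
        (algebraMap (MvPolynomial (Fin n) (MvPolynomial (Fin t) ℚ)) _) := by
    rw [idealK_eq_map]
    exact (Ideal.map_map _ _).symm
  rw [h1, IsLocalization.mem_map_algebraMap_iff
    ((nonZeroDivisors (MvPolynomial (Fin t) ℚ)).map
      (C : _ →+* MvPolynomial (Fin n) (MvPolynomial (Fin t) ℚ)))] at hp
  obtain ⟨⟨⟨a, ha⟩, ⟨m, hm⟩⟩, h⟩ := hp
  obtain ⟨s, hs, rfl⟩ := hm
  obtain ⟨q, hq, rfl⟩ := (Ideal.mem_map_of_equiv _ _).1 ha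
  refine ⟨algebraMap _ _ s, ?_, q, hq, ?_⟩
  · exact IsLocalization.to_map_ne_zero_of_mem_nonZeroDivisors _ le_rfl hs
  · refine Eq.trans h.symm ?_
    rw [mul_comm]
    congr 1
    exact map_C _ _

/-- Leading monomials of elements of `⟨f⟩_𝕂` are reducible by a Gröbner basis of `⟨f⟩`. -/
theorem grevlex_degree_notMem_basisB {f : Fin n → ParamPoly n t} {G : Set (ParamPoly n t)}
    (hG : IsGroebnerBasis (elimOrder n t) (Ideal.span (Set.range f)) G)
    {p : MvPolynomial (Fin n) (RatFun t)} (hp : p ∈ idealK f) (hp0 : p ≠ 0) :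
    (grevlex n).degree p ∉ basisB G := by
  obtain ⟨s, hs, q, hq, hqp⟩ := exists_toK_eq_of_mem_idealK hp
  have hq0 : q ≠ 0 := by
    rintro rfl
    rw [map_zero] at hqp
    exact mul_ne_zero (C_ne_zero.2 hs) hp0 hqp.symm
  have hdeg : (grevlex n).degree (toK n t q) = (grevlex n).degree p := by
    rw [hqp, (grevlex n).degree_mul (C_ne_zero.2 hs) hp0, (grevlex n).degree_C, zero_add]
  have h1 : monomial ((elimOrder n t).degree q) 1 ∈ initialIdeal (elimOrder n t) G := by
    rw [hG.initialIdeal_eq]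
    exact Ideal.subset_span ⟨q, hq, hq0, rfl⟩
  have h2 : {r | ∃ p ∈ G, p ≠ 0 ∧ r = monomial ((elimOrder n t).degree p) (1 : ℚ)} =
      (fun a => monomial a (1 : ℚ)) '' {a | ∃ p ∈ G, p ≠ 0 ∧ a = (elimOrder n t).degree p} := by
    ext r
    constructor
    · rintro ⟨p, hp, hp0, rfl⟩
      exact ⟨_, ⟨p, hp, hp0, rfl⟩, rfl⟩
    · rintro ⟨_, ⟨p, hp, hp0, rfl⟩, rfl⟩
      exact ⟨p, hp, hp0, rfl⟩
  rw [initialIdeal, h2, mem_ideal_span_monomial_image] at h1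
  obtain ⟨_, ⟨g, hg, hg0, rfl⟩, hle⟩ := h1 ((elimOrder n t).degree q) (by simp)
  intro hB
  refine hB g hg ?_
  rw [← hdeg, grevlex_degree_toK hg0, grevlex_degree_toK hq0]
  exact fun i => hle (Sum.inl i)

/-- The monomials of `basisB G` are linearly independent modulo `⟨f⟩_𝕂`. -/
theorem eq_zero_of_mem_idealK {f : Fin n → ParamPoly n t} {G : Set (ParamPoly n t)}
    (hG : IsGroebnerBasis (elimOrder n t) (Ideal.span (Set.range f)) G)
    {p : MvPolynomial (Fin n) (RatFun t)} (hp : p ∈ idealK f)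
    (hB : (p.support : Set (Fin n →₀ ℕ)) ⊆ basisB G) : p = 0 := by
  by_contra hp0
  exact grevlex_degree_notMem_basisB hG hp hp0 (hB ((grevlex n).degree_mem_support hp0))

end Elimination

/-! ### Forms of largest degree -/

section TopForms

variable {n t : ℕ} {σ K : Type*} [Field K]

theorem coeff_topForm (p : MvPolynomial σ K) (a : σ →₀ ℕ) (ha : p.totalDegree ≤ a.degree) :
    coeff a (topForm p) = coeff a p := by
  rw [topForm, coeff_homogeneousComponent]
  split_ifs with h
  · rfl
  · exact (coeff_eq_zero_of_totalDegree_lt (lt_of_le_of_ne ha (Ne.symm h))).symm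

theorem totalDegree_topForm (p : MvPolynomial σ K) : (topForm p).totalDegree = p.totalDegree := by
  by_cases hp : p = 0
  · simp [hp, topForm]
  · refine (homogeneousComponent_isHomogeneous _ p).totalDegree fun h0 => ?_
    obtain ⟨a, ha, hdeg⟩ := Finset.exists_mem_eq_sup _ (support_nonempty.2 hp)
      (fun c : σ →₀ ℕ => c.sum fun _ e => e)
    have h1 : p.totalDegree = a.degree := hdeg
    have h2 := coeff_topForm p a h1.le
    rw [topForm, h0, coeff_zero] at h2
    exact mem_support_iff.1 ha h2.symm

/-- A form in the ideal of the top forms of the `F i` is the part of largest degree of an element of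
the ideal of the `F i`. -/
theorem exists_coeff_eq_of_mem_span_topForm {ι : Type*} [Finite ι] (F : ι → MvPolynomial σ K)
    {p : MvPolynomial σ K} (hp : p ∈ Ideal.span (Set.range fun i => topForm (F i))) (k : ℕ) :
    ∃ q ∈ Ideal.span (Set.range F), ∀ a : σ →₀ ℕ, k ≤ a.degree →
      coeff a q = coeff a (homogeneousComponent k p) := by
  have := Fintype.ofFinite ι
  obtain ⟨c, rfl⟩ := (Submodule.mem_span_range_iff_exists_fun _).1 hp
  refine ⟨∑ i, if (F i).totalDegree ≤ k then
    homogeneousComponent (k - (F i).totalDegree) (c i) * F i else 0, ?_, ?_⟩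
  · refine sum_mem fun i _ => ?_
    split_ifs
    · exact Ideal.mul_mem_left _ _ (Ideal.subset_span ⟨i, rfl⟩)
    · exact zero_mem _
  · intro a ha
    rw [map_sum, coeff_sum, coeff_sum]
    refine Finset.sum_congr rfl fun i _ => ?_
    have hF : (topForm (F i)).IsHomogeneous (F i).totalDegree :=
      homogeneousComponent_isHomogeneous _ _
    rw [smul_eq_mul, homogeneousComponent_mul_of_isHomogeneous hF]
    split_ifs with hk
    · classical
      rw [coeff_mul, coeff_mul]
      refine Finset.sum_congr rfl fun x hx => ?_
      by_cases h1 : x.1.degree = k - (F i).totalDegree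
      · have h2 : x.1.degree + x.2.degree = a.degree := by
          rw [← map_add, Finset.HasAntidiagonal.mem_antidiagonal.1 hx]
        rw [coeff_topForm _ _ (by omega)]
      · rw [(homogeneousComponent_isHomogeneous _ (c i)).coeff_eq_zero h1, zero_mul, zero_mul]
    · rfl

/-- The monomials of degree `k` of `basisB G` are linearly independent modulo the top forms of `f`:
since grevlex is graded, a form `p` in the ideal of the top forms and the element of `⟨f⟩_𝕂` with
leading part `p` have the same leading monomial. -/
theorem eq_zero_of_mem_span_topForm {f : Fin n → ParamPoly n t} {G : Set (ParamPoly n t)}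
    (hG : IsGroebnerBasis (elimOrder n t) (Ideal.span (Set.range f)) G) {k : ℕ}
    {p : MvPolynomial (Fin n) (RatFun t)}
    (hp : p ∈ Ideal.span (Set.range fun i => topForm (toK n t (f i))))
    (hB : (p.support : Set (Fin n →₀ ℕ)) ⊆ {b ∈ basisB G | b.degree = k}) : p = 0 := by
  by_contra hp0
  obtain ⟨q, hq, hqp⟩ := exists_coeff_eq_of_mem_span_topForm (fun i => toK n t (f i)) hp k
  have hpk : p.IsHomogeneous k := by
    rw [← mem_homogeneousSubmodule, homogeneousSubmodule_eq_restrictSupport,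
      mem_restrictSupport_iff]
    exact fun a ha => (hB ha).2
  rw [homogeneousComponent_eq_self hpk] at hqp
  have hm := (grevlex n).degree_mem_support hp0
  have hmk := (hB hm).2
  have hmq : (grevlex n).degree p ∈ q.support := by
    rw [mem_support_iff, hqp _ hmk.ge]
    exact mem_support_iff.1 hm
  have hq0 : q ≠ 0 := by
    rintro rfl
    simp at hmq
  have hle := degree_le_of_grevlex_le ((grevlex n).le_degree hmq)
  have hmem : (grevlex n).degree q ∈ p.support := by
    rw [mem_support_iff, ← hqp _ (hmk.symm.le.trans hle)]
    exact mem_support_iff.1 ((grevlex n).degree_mem_support hq0)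
  exact grevlex_degree_notMem_basisB hG hq hq0 (hB hmem).1

theorem degree_bounds_basisB {f : Fin n → ParamPoly n t} {G : Set (ParamPoly n t)} {d : ℕ}
    (hreg : IsAffineRegular f)
    (hG : IsGroebnerBasis (elimOrder n t) (Ideal.span (Set.range f)) G)
    (hd : ∀ i, (f i).totalDegree ≤ d) :
    (∀ b ∈ basisB G, b.degree ≤ n * (d - 1)) ∧ ∃ hfin : (basisB G).Finite,
      2 * ∑ b ∈ hfin.toFinset, b.degree ≤ n * (d - 1) * d ^ n := by
  set H := fun i => topForm (toK n t (f i)) with hH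
  have hhom : ∀ i, (H i).IsHomogeneous (H i).totalDegree := fun i => by
    rw [hH, totalDegree_topForm]
    exact homogeneousComponent_isHomogeneous _ _
  have he : ∀ i, (H i).totalDegree ≤ d := fun i => by
    rw [hH, totalDegree_topForm, totalDegree_toK]
    exact (degX_le_totalDegree _).trans (hd i)
  have hcount : ∀ k, (({b ∈ basisB G | b.degree = k}.ncard : ℕ) : ℤ) ≤
      (completeIntersectionPoly fun i => (H i).totalDegree).coeff k := by
    intro k
    rw [← Polynomial.coeff_coe, ← hilbertSeries_ofFn H hreg hhom]
    exact ncard_le_coeff_hilbertSeries _ k _ (fun a ha => ha.2)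
      fun p hp hB => eq_zero_of_mem_span_topForm hG hp hB
  obtain ⟨h1, hfin, h2⟩ := degree_bounds_of_ncard_le _ _ hcount
  refine ⟨fun b hb => (h1 b hb).trans (natDegree_completeIntersectionPoly_le he), hfin, ?_⟩
  have h3 := two_mul_eval_derivative_completeIntersectionPoly_le he
  have h4 : (2 : ℤ) * ((∑ b ∈ hfin.toFinset, b.degree : ℕ) : ℤ) ≤
    ((n * (d - 1) * d ^ n : ℕ) : ℤ) := le_trans (by linarith) h3
  exact_mod_cast h4

end TopForms

/-! ### Normal forms and the monomial basis -/

section NormalForm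

variable {n t : ℕ} {f : Fin n → ParamPoly n t} {G : Set (ParamPoly n t)}

theorem mk_monomial (b : Fin n →₀ ℕ) (r : RatFun t) :
    Ideal.Quotient.mk (idealK f) (monomial b r) = r • monoClass f b := by
  rw [monoClass, ← Ideal.Quotient.mkₐ_eq_mk (RatFun t), ← map_smul, smul_monomial, smul_eq_mul,
    mul_one]

theorem monoClass_add (a b : Fin n →₀ ℕ) :
    monoClass f (a + b) = monoClass f a * monoClass f b := by
  rw [monoClass, monoClass, monoClass, ← map_mul, monomial_mul, one_mul]

/-- One step of the division of `x ^ a` by `g`. -/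
theorem leadingCoeff_smul_monoClass {g : ParamPoly n t} (hg : g ∈ Ideal.span (Set.range f))
    (hg0 : g ≠ 0) {a : Fin n →₀ ℕ} (ha : (grevlex n).degree (toK n t g) ≤ a) :
    (grevlex n).leadingCoeff (toK n t g) • monoClass f a =
      -∑ c ∈ (toK n t g).support.erase ((grevlex n).degree (toK n t g)),
        coeff c (toK n t g) • monoClass f (c + (a - (grevlex n).degree (toK n t g))) := by
  set m := (grevlex n).degree (toK n t g) with hm
  have h1 : Ideal.Quotient.mk (idealK f) (toK n t g * monomial (a - m) 1) = 0 :=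
    Ideal.Quotient.eq_zero_iff_mem.2 (Ideal.mul_mem_right _ _ (toK_mem_idealK hg))
  have h2 : toK n t g * monomial (a - m) 1 =
      ∑ c ∈ (toK n t g).support, monomial (c + (a - m)) (coeff c (toK n t g)) := by
    conv_lhs => rw [(toK n t g).as_sum]
    rw [Finset.sum_mul]
    exact Finset.sum_congr rfl fun c _ => by rw [monomial_mul, mul_one]
  rw [h2, map_sum, ← Finset.add_sum_erase _ _
    ((grevlex n).degree_mem_support (toK_ne_zero hg0)), ← hm, add_tsub_cancel_of_le ha] at h1
  simp only [mk_monomial] at h1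
  exact eq_neg_of_add_eq_zero_left h1

theorem grevlex_add_tsub_lt {p : MvPolynomial (Fin n) (RatFun t)} {a c : Fin n →₀ ℕ}
    (ha : (grevlex n).degree p ≤ a) (hc : c ∈ p.support.erase ((grevlex n).degree p)) :
    (grevlex n).toSyn (c + (a - (grevlex n).degree p)) < (grevlex n).toSyn a := by
  rw [Finset.mem_erase] at hc
  have h1 : (grevlex n).toSyn c < (grevlex n).toSyn ((grevlex n).degree p) :=
    lt_of_le_of_ne ((grevlex n).le_degree hc.2) fun h => hc.1 ((grevlex n).toSyn.injective h)
  conv_rhs => rw [← add_tsub_cancel_of_le ha]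
  rw [map_add, map_add]
  exact add_lt_add_left h1 _

theorem ne_zero_of_mem_reduced
    (hG : IsReducedGroebnerBasis (elimOrder n t) (Ideal.span (Set.range f)) G)
    {g : ParamPoly n t} (hg : g ∈ G) : g ≠ 0 := by
  rintro rfl
  simpa using hG.monic 0 hg

theorem mem_span_of_mem_reduced
    (hG : IsReducedGroebnerBasis (elimOrder n t) (Ideal.span (Set.range f)) G)
    {g : ParamPoly n t} (hg : g ∈ G) : g ∈ Ideal.span (Set.range f) := by
  rw [← hG.span_eq]
  exact Ideal.subset_span hg

theorem monoClass_mem_span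
    (hG : IsReducedGroebnerBasis (elimOrder n t) (Ideal.span (Set.range f)) G)
    (a : Fin n →₀ ℕ) :
    monoClass f a ∈ Submodule.span (RatFun t)
      (Set.range fun b : basisB G => monoClass f (b : Fin n →₀ ℕ)) := by
  induction h : (grevlex n).toSyn a using WellFoundedLT.induction generalizing a with
  | ind s ih =>
    subst h
    by_cases ha : a ∈ basisB G
    · exact Submodule.subset_span ⟨⟨a, ha⟩, rfl⟩
    · simp only [basisB, Set.mem_ofPred_eq, not_forall, not_not] at ha
      obtain ⟨g, hg, hle⟩ := ha
      have hg0 := ne_zero_of_mem_reduced hG hg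
      have hlc : (grevlex n).leadingCoeff (toK n t g) ≠ 0 :=
        (grevlex n).leadingCoeff_ne_zero_iff.2 (toK_ne_zero hg0)
      rw [← Submodule.smul_mem_iff _ hlc,
        leadingCoeff_smul_monoClass (mem_span_of_mem_reduced hG hg) hg0 hle]
      exact neg_mem (sum_mem fun c hc =>
        Submodule.smul_mem _ _ (ih _ (grevlex_add_tsub_lt hle hc) _ rfl))

theorem exists_basis
    (hG : IsReducedGroebnerBasis (elimOrder n t) (Ideal.span (Set.range f)) G) :
    ∃ β : Module.Basis (basisB G) (RatFun t) (quotK f), ∀ b, β b = monoClass f b := by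
  have hli : LinearIndependent (RatFun t)
      (fun b : basisB G => monoClass f (b : Fin n →₀ ℕ)) := by
    have h1 : LinearIndependent (RatFun t)
        (fun b : basisB G => (monomial (b : Fin n →₀ ℕ) (1 : RatFun t))) := by
      have := (basisMonomials (Fin n) (RatFun t)).linearIndependent
      rw [coe_basisMonomials] at this
      exact this.comp _ Subtype.val_injective
    refine h1.map (f := (Ideal.Quotient.mkₐ (RatFun t) (idealK f)).toLinearMap) ?_
    have h2 : Submodule.span (RatFun t) (Set.range fun b : basisB G =>
        (monomial (b : Fin n →₀ ℕ) (1 : RatFun t))) = restrictSupport (RatFun t) (basisB G) := by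
      rw [restrictSupport_eq_span, Set.image_eq_range]
    rw [h2, Submodule.disjoint_def]
    intro p hp hker
    exact eq_zero_of_mem_idealK hG.toIsGroebnerBasis
      (Ideal.Quotient.eq_zero_iff_mem.1 (LinearMap.mem_ker.1 hker))
      ((mem_restrictSupport_iff _).1 hp)
  refine ⟨Module.Basis.mk hli ?_, fun b => Module.Basis.mk_apply _ _ _⟩
  rintro x -
  obtain ⟨p, rfl⟩ := Ideal.Quotient.mk_surjective x
  rw [p.as_sum, map_sum]
  refine sum_mem fun a _ => ?_
  rw [mk_monomial]
  exact Submodule.smul_mem _ _ (monoClass_mem_span hG a)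

end NormalForm

/-! ### Degree bounds for the Hermite matrix -/

section DegreeBounds

variable {n t : ℕ}

/-- The element `h` of `ℚ(y)` is `0` or a polynomial in `ℚ[y]` of total degree at most `N - s`,
where `N - s` may be negative. -/
def IsPolyOfDegreeAddLE (h : RatFun t) (s N : ℕ) : Prop :=
  ∃ p : MvPolynomial (Fin t) ℚ,
    algebraMap (MvPolynomial (Fin t) ℚ) (RatFun t) p = h ∧ (p ≠ 0 → p.totalDegree + s ≤ N)

namespace IsPolyOfDegreeAddLE

variable {h h' : RatFun t} {s s' N N' : ℕ}

theorem zero : IsPolyOfDegreeAddLE (0 : RatFun t) s N := ⟨0, map_zero _, fun h => absurd rfl h⟩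

theorem one (hs : s ≤ N) : IsPolyOfDegreeAddLE (1 : RatFun t) s N :=
  ⟨1, map_one _, fun _ => by simpa using hs⟩

theorem congr (hh : IsPolyOfDegreeAddLE h s N) (h1 : N + s' ≤ N' + s) :
    IsPolyOfDegreeAddLE h s' N' := by
  obtain ⟨p, hp, h2⟩ := hh
  exact ⟨p, hp, fun h0 => by have := h2 h0; omega⟩

theorem neg (hh : IsPolyOfDegreeAddLE h s N) : IsPolyOfDegreeAddLE (-h) s N := by
  obtain ⟨p, rfl, h2⟩ := hh
  exact ⟨-p, map_neg _ _, fun h0 => by rw [totalDegree_neg]; exact h2 (neg_ne_zero.1 h0)⟩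

theorem add (hh : IsPolyOfDegreeAddLE h s N) (hh' : IsPolyOfDegreeAddLE h' s N) :
    IsPolyOfDegreeAddLE (h + h') s N := by
  obtain ⟨p, rfl, h1⟩ := hh
  obtain ⟨q, rfl, h2⟩ := hh'
  refine ⟨p + q, map_add _ _ _, fun h0 => ?_⟩
  by_cases hp : p = 0
  · subst hp; rw [zero_add] at h0 ⊢; exact h2 h0
  by_cases hq : q = 0
  · subst hq; rw [add_zero] at h0 ⊢; exact h1 h0
  have := totalDegree_add p q
  have := h1 hp
  have := h2 hq
  omega

theorem mul (hh : IsPolyOfDegreeAddLE h s N) (hh' : IsPolyOfDegreeAddLE h' s' N') :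
    IsPolyOfDegreeAddLE (h * h') (s + s') (N + N') := by
  obtain ⟨p, rfl, h1⟩ := hh
  obtain ⟨q, rfl, h2⟩ := hh'
  refine ⟨p * q, map_mul _ _ _, fun h0 => ?_⟩
  have := totalDegree_mul p q
  have := h1 (left_ne_zero_of_mul h0)
  have := h2 (right_ne_zero_of_mul h0)
  omega

theorem sum {ι : Type*} (S : Finset ι) {u : ι → RatFun t}
    (hu : ∀ i ∈ S, IsPolyOfDegreeAddLE (u i) s N) : IsPolyOfDegreeAddLE (∑ i ∈ S, u i) s N :=
  Finset.sum_induction u (IsPolyOfDegreeAddLE · s N) (fun _ _ => add) zero hu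

theorem prod {ι : Type*} (S : Finset ι) {u : ι → RatFun t} {D : ι → ℕ}
    (hu : ∀ i ∈ S, IsPolyOfDegreeAddLE (u i) 0 (D i)) :
    IsPolyOfDegreeAddLE (∏ i ∈ S, u i) 0 (∑ i ∈ S, D i) := by
  classical
  induction S using Finset.induction_on with
  | empty => exact one le_rfl
  | insert i S hi ih =>
    rw [Finset.prod_insert hi, Finset.sum_insert hi]
    exact (hu i (by simp)).mul (ih fun j hj => hu j (by simp [hj]))

theorem isPolyOfDegreeLE (hh : IsPolyOfDegreeAddLE h 0 N) : IsPolyOfDegreeLE h N := by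
  obtain ⟨p, hp, h1⟩ := hh
  refine ⟨p, hp, ?_⟩
  by_cases h0 : p = 0
  · simp [h0]
  · exact h1 h0

end IsPolyOfDegreeAddLE

variable {f : Fin n → ParamPoly n t} {G : Set (ParamPoly n t)}

theorem coeff_toK_isPolyOfDegreeAddLE (p : ParamPoly n t) (a : Fin n →₀ ℕ) :
    IsPolyOfDegreeAddLE (coeff a (toK n t p)) a.degree p.totalDegree :=
  ⟨_, (coeff_toK p a).symm, totalDegree_coeff_add_le p⟩

/-- If the total degree of `g` is reached in `x` alone, then the coefficient in `ℚ[y]` of its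
leading monomial in `x` is constant. -/
theorem leadingCoeff_toK_eq_one {g : ParamPoly n t} (hg : g.totalDegree = degX g)
    (hmonic : (elimOrder n t).leadingCoeff g = 1) :
    (grevlex n).leadingCoeff (toK n t g) = 1 := by
  have hg0 : g ≠ 0 := by
    rintro rfl
    simp at hmonic
  set e := (elimOrder n t).degree g with he
  set a := (Finsupp.sumFinsuppAddEquivProdFinsupp e).1 with ha
  set c := (Finsupp.sumFinsuppAddEquivProdFinsupp e).2 with hc
  have hdeg : (grevlex n).degree (toK n t g) = a := grevlex_degree_toK hg0
  have hac : Finsupp.sumElim a c = e := sumElim_sumFinsuppAddEquivProdFinsupp e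
  have h1 : coeff c (coeff a (sumAlgEquiv ℚ (Fin n) (Fin t) g)) = 1 := by
    rw [coeff_coeff_sumAlgEquiv, hac]
    exact hmonic
  have h2 : coeff a (sumAlgEquiv ℚ (Fin n) (Fin t) g) ≠ 0 := by
    intro h0
    simp [h0] at h1
  have h3 := totalDegree_coeff_add_le g h2
  rw [hg, ← totalDegree_toK, ← degree_grevlex_degree (toK n t g), hdeg] at h3
  -- The coefficient of `x ^ a` has degree `0` in `y`, as `x ^ a` alone reaches the total degree.
  have h4 := totalDegree_eq_zero_iff_eq_C.1
    (show (coeff a (sumAlgEquiv ℚ (Fin n) (Fin t) g)).totalDegree = 0 by omega)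
  have h5 : c = 0 := by
    by_contra h0
    rw [h4, coeff_C, if_neg (Ne.symm h0)] at h1
    exact zero_ne_one h1
  rw [h5] at h1
  rw [MonomialOrder.leadingCoeff, hdeg, coeff_toK, h4, h1, C_1, map_one]

/-- Division by `G` does not increase the total degree in `(y, x)`. -/
theorem repr_monoClass_isPolyOfDegreeAddLE
    (hG : IsReducedGroebnerBasis (elimOrder n t) (Ideal.span (Set.range f)) G)
    (hE : AssumptionE G) (β : Module.Basis (basisB G) (RatFun t) (quotK f))
    (hβ : ∀ b, β b = monoClass f b) (a : Fin n →₀ ℕ) (b : basisB G) :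
    IsPolyOfDegreeAddLE (β.repr (monoClass f a) b) (b : Fin n →₀ ℕ).degree a.degree := by
  induction h : (grevlex n).toSyn a using WellFoundedLT.induction generalizing a with
  | ind s ih =>
    subst h
    by_cases ha : a ∈ basisB G
    · rw [← hβ ⟨a, ha⟩, β.repr_self]
      by_cases hab : ⟨a, ha⟩ = b
      · subst hab
        rw [Finsupp.single_eq_same]
        exact .one le_rfl
      · rw [Finsupp.single_eq_of_ne' hab]
        exact .zero
    · simp only [basisB, Set.mem_ofPred_eq, not_forall, not_not] at ha
      obtain ⟨g, hg, hle⟩ := ha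
      have hred := leadingCoeff_smul_monoClass (mem_span_of_mem_reduced hG hg)
        (ne_zero_of_mem_reduced hG hg) hle
      rw [leadingCoeff_toK_eq_one (hE g hg) (hG.monic g hg), one_smul] at hred
      rw [hred, map_neg, map_sum, Finsupp.neg_apply, Finsupp.finsetSum_apply]
      refine IsPolyOfDegreeAddLE.neg (.sum _ fun c hc => ?_)
      rw [map_smul, Finsupp.smul_apply, smul_eq_mul]
      refine ((coeff_toK_isPolyOfDegreeAddLE g c).mul
        (ih _ (grevlex_add_tsub_lt hle hc) _ rfl)).congr ?_
      have h1 : (c + (a - (grevlex n).degree (toK n t g))).degree +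
          ((grevlex n).degree (toK n t g)).degree = c.degree + a.degree := by
        rw [← map_add, add_assoc, tsub_add_cancel_of_le hle, map_add]
      rw [degree_grevlex_degree, totalDegree_toK, ← hE g hg] at h1
      omega

/-- The trace at `(b, b')` is the sum over the basis monomials `k` of the coordinate at `k` of
`b * b' * k`, and each of these has degree at most `deg b + deg b'`. -/
theorem hermiteMatrix_isPolyOfDegreeAddLE (hfin : (basisB G).Finite)
    (hG : IsReducedGroebnerBasis (elimOrder n t) (Ideal.span (Set.range f)) G)
    (hE : AssumptionE G) (b b' : basisB G) :
    IsPolyOfDegreeAddLE (hermiteMatrix f (basisB G) b b') 0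
      ((b : Fin n →₀ ℕ).degree + (b' : Fin n →₀ ℕ).degree) := by
  classical
  obtain ⟨β, hβ⟩ := exists_basis hG
  have := hfin.fintype
  rw [hermiteMatrix, Matrix.of_apply, Algebra.trace_eq_matrix_trace β, Matrix.trace]
  refine .sum _ fun k _ => ?_
  rw [Matrix.diag_apply, Algebra.leftMulMatrix_eq_repr_mul, hβ, ← monoClass_add, ← monoClass_add]
  refine (repr_monoClass_isPolyOfDegreeAddLE hG hE β hβ _ k).congr ?_
  simp only [map_add]
  omega

/-- Every term of the Leibniz expansion of a minor has degree at most the sum of the degrees of the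
row and column monomials, and each of these two sums is at most the one over `basisB G`. -/
theorem minor_hermiteMatrix_isPolyOfDegreeLE {κ : Type*} [Fintype κ] [DecidableEq κ]
    (hfin : (basisB G).Finite)
    (hG : IsReducedGroebnerBasis (elimOrder n t) (Ideal.span (Set.range f)) G)
    (hE : AssumptionE G) (r c : κ ↪ basisB G) :
    IsPolyOfDegreeLE ((hermiteMatrix f (basisB G)).submatrix r c).det
      (2 * ∑ b ∈ hfin.toFinset, b.degree) := by
  have hsum : ∀ u : κ ↪ basisB G,
      ∑ i, (u i : Fin n →₀ ℕ).degree ≤ ∑ b ∈ hfin.toFinset, b.degree := by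
    intro u
    have h1 := Finset.sum_map Finset.univ (u.trans (Function.Embedding.subtype _))
      (fun b : Fin n →₀ ℕ => b.degree)
    refine le_trans (le_of_eq h1.symm) (Finset.sum_le_sum_of_subset fun b hb => ?_)
    obtain ⟨i, -, rfl⟩ := Finset.mem_map.1 hb
    exact hfin.mem_toFinset.2 (u i).2
  refine IsPolyOfDegreeAddLE.isPolyOfDegreeLE ?_
  rw [Matrix.det_apply]
  refine .sum _ fun τ _ => ?_
  have h1 : IsPolyOfDegreeAddLE (∏ i, (hermiteMatrix f (basisB G)).submatrix r c (τ i) i) 0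
      (2 * ∑ b ∈ hfin.toFinset, b.degree) := by
    refine (IsPolyOfDegreeAddLE.prod _ fun i _ =>
      hermiteMatrix_isPolyOfDegreeAddLE hfin hG hE (r (τ i)) (c i)).congr ?_
    rw [Finset.sum_add_distrib, Equiv.sum_comp τ fun i => (r i : Fin n →₀ ℕ).degree]
    have := hsum r
    have := hsum c
    omega
  rcases Int.units_eq_one_or (Equiv.Perm.sign τ) with h | h
  · rwa [h, one_smul]
  · rw [h, Units.neg_smul, one_smul]
    exact h1.neg

end DegreeBounds

end ParamHermite

theorem mainTheorem7 (n t : ℕ) (f : Fin n → ParamHermite.ParamPoly n t)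
    (G : Set (ParamHermite.ParamPoly n t)) (d : ℕ)
    (hreg : ParamHermite.IsAffineRegular f)
    (hG : ParamHermite.IsReducedGroebnerBasis (ParamHermite.elimOrder n t)
      (Ideal.span (Set.range f)) G)
    (hd : d = Finset.univ.sup fun i => (f i).totalDegree) :
    -- the monomials not reducible by `G` are finitely many and form a basis of `A_𝕂`
    ∃ hfin : (ParamHermite.basisB G).Finite,
      (∃ β : Module.Basis (ParamHermite.basisB G) (ParamHermite.RatFun t) (ParamHermite.quotK f),
        ∀ b, β b = ParamHermite.monoClass f b) ∧
      -- degree bounds for this basis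
      (∀ b ∈ ParamHermite.basisB G, b.degree ≤ n * (d - 1)) ∧
      2 * ∑ b ∈ hfin.toFinset, b.degree ≤ n * (d - 1) * d ^ n ∧
      -- degree bounds for the minors and for the determinant
      (ParamHermite.AssumptionE G →
        (∀ (l : ℕ) (r c : Fin l ↪ ParamHermite.basisB G),
          ParamHermite.IsPolyOfDegreeLE
            ((ParamHermite.hermiteMatrix f (ParamHermite.basisB G)).submatrix r c).det
            (n * (d - 1) * d ^ n)) ∧
        (∀ [Fintype (ParamHermite.basisB G)],
          ParamHermite.IsPolyOfDegreeLE
            (ParamHermite.hermiteMatrix f (ParamHermite.basisB G)).det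
            (n * (d - 1) * d ^ n))) := by
  obtain ⟨h1, hfin, h2⟩ := ParamHermite.degree_bounds_basisB hreg hG.toIsGroebnerBasis
    (d := d) fun i => hd ▸ Finset.le_sup (f := fun i => (f i).totalDegree) (Finset.mem_univ i)
  refine ⟨hfin, ParamHermite.exists_basis hG, h1, h2, fun hE => ⟨fun l r c => ?_, ?_⟩⟩
  · obtain ⟨p, hp, hdeg⟩ := ParamHermite.minor_hermiteMatrix_isPolyOfDegreeLE hfin hG hE r c
    exact ⟨p, hp, hdeg.trans h2⟩
  · intro _
    obtain ⟨p, hp, hdeg⟩ := ParamHermite.minor_hermiteMatrix_isPolyOfDegreeLE hfin hG hE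
      (Function.Embedding.refl _) (Function.Embedding.refl _)
    exact ⟨p, hp, hdeg.trans h2⟩
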